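/- Let $p,\beta,\sigma,\epsilon>0$ be constants and let $\alpha,\gamma:\mathbb R\to\mathbb R$ be continuous, positive and $p$-periodic. Write $\bar b=\frac1p\int_0^p b(s)\,ds$. Consider the system $$x'=\alpha(t)-\beta\,\frac{x}{y},\qquad y'=-\gamma(t)+\sigma\,\frac{x}{y}+\frac{\epsilon}{y}.$$ A positive $p$-periodic solution $(x(t),y(t))$, $t\in\mathbb R$ (that is, $x(t)>0$ and $y(t)>0$ for all $t$), exists if and only if $$\beta\bar\gamma-\sigma\bar\alpha>0.$$ If this condition holds, the positive $p$-periodic solution $(x,y)$ is unique, and it attracts all other positive solutions as $t\to\infty$: for every $t_0\in\mathbb R$ and all $u_0,v_0>0$ there is a positive solution $(u,v)$ on $[t_0,\infty)$ with $u(t_0)=u_0$, $v(t_0)=v_0$, and every positive solution $(u,v)$ on $[t_0,\infty)$ satisfies $u(t)-x(t)\to0$ and $v(t)-y(t)\to0$ as $t\to\infty$. -/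

import Mathlib

open Set Filter Topology

noncomputable section

/-- The mean value of `b` over `[0, p]`. -/
def meanValue (p : ℝ) (b : ℝ → ℝ) : ℝ :=
  (1 / p) * ∫ t in (0 : ℝ)..p, b t

/-- `(x, y)` is a positive (classical) solution on the time set `J` of the system
`x' = α(t) - β x / y`, `y' = -γ(t) + σ x / y + ε / y`.
The derivatives at an endpoint belonging to `J` are one-sided. -/
structure IsPositiveSolutionOn (α γ : ℝ → ℝ) (β σ ε : ℝ) (J : Set ℝ) (x y : ℝ → ℝ) : Prop where
  pos_x : ∀ t ∈ J, 0 < x t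
  pos_y : ∀ t ∈ J, 0 < y t
  deriv_x : ∀ t ∈ J, HasDerivWithinAt x (α t - β * (x t / y t)) J t
  deriv_y : ∀ t ∈ J, HasDerivWithinAt y (-γ t + σ * (x t / y t) + ε / y t) J t

/-- `(x, y)` is a positive `p`-periodic solution of the system, on the whole time axis. -/
structure IsPositivePeriodicSolution (α γ : ℝ → ℝ) (β σ ε p : ℝ) (x y : ℝ → ℝ) : Prop where
  solution : IsPositiveSolutionOn α γ β σ ε univ x y
  periodic_x : Function.Periodic x p
  periodic_y : Function.Periodic y p

end

/-! In `σ x + β y` the terms `x / y` cancel: its derivative is `σ α - β γ + β ε / y`. Integrating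
over a period of a positive periodic solution leaves the positive term `β ε / y`, whence the mean
value condition.

The same cancellation governs differences of solutions. Since `x / y` increases in `x` and decreases
in `y`, the distance `σ |Δx| + β |Δy|` never grows (`dist_le`); this gives uniqueness for initial
values. Raising the weight `σ` to `σ + η` makes the decay exponential, provided the solutions are
bounded above (`weighted_dist_le`, `exists_exp_dist_le`). The mean value condition supplies these
bounds through a Lyapunov function (`exists_upper_bound`), so any two positive solutions attract
each other.

For existence, a solution is compared with its own translate by `p`: its values at multiples of `p`
form a Cauchy sequence. Lower bounds keep the limit positive, and nonexpansiveness makes it a fixed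
point of the period map. Uniqueness of the periodic solution follows from attraction. -/

/-! ### Restriction of solutions and one-sided derivatives -/

lemma IsPositiveSolutionOn.mono {α γ : ℝ → ℝ} {β σ ε : ℝ} {J K : Set ℝ} {x y : ℝ → ℝ}
    (h : IsPositiveSolutionOn α γ β σ ε J x y) (hK : K ⊆ J) :
    IsPositiveSolutionOn α γ β σ ε K x y where
  pos_x t ht := h.pos_x t (hK ht)
  pos_y t ht := h.pos_y t (hK ht)
  deriv_x t ht := (h.deriv_x t (hK ht)).mono hK
  deriv_y t ht := (h.deriv_y t (hK ht)).mono hK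

lemma IsPositiveSolutionOn.congr {α γ : ℝ → ℝ} {β σ ε : ℝ} {J : Set ℝ} {x y u v : ℝ → ℝ}
    (h : IsPositiveSolutionOn α γ β σ ε J x y) (hu : EqOn u x J) (hv : EqOn v y J) :
    IsPositiveSolutionOn α γ β σ ε J u v where
  pos_x t ht := by rw [hu ht]; exact h.pos_x t ht
  pos_y t ht := by rw [hv ht]; exact h.pos_y t ht
  deriv_x t ht := by rw [hu ht, hv ht]; exact (h.deriv_x t ht).congr hu (hu ht)
  deriv_y t ht := by rw [hu ht, hv ht]; exact (h.deriv_y t ht).congr hv (hv ht)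

lemma IsPositiveSolutionOn.continuousOn_x {α γ : ℝ → ℝ} {β σ ε : ℝ} {J : Set ℝ} {x y : ℝ → ℝ}
    (h : IsPositiveSolutionOn α γ β σ ε J x y) : ContinuousOn x J :=
  fun t ht => (h.deriv_x t ht).continuousWithinAt

lemma IsPositiveSolutionOn.continuousOn_y {α γ : ℝ → ℝ} {β σ ε : ℝ} {J : Set ℝ} {x y : ℝ → ℝ}
    (h : IsPositiveSolutionOn α γ β σ ε J x y) : ContinuousOn y J :=
  fun t ht => (h.deriv_y t ht).continuousWithinAt

lemma HasDerivWithinAt.Ici_of_Icc {f : ℝ → ℝ} {f' a b t : ℝ}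
    (h : HasDerivWithinAt f f' (Icc a b) t) (ht : t ∈ Ico a b) :
    HasDerivWithinAt f f' (Ici t) t := by
  refine h.mono_of_mem_nhdsWithin ?_
  filter_upwards [Icc_mem_nhdsGE ht.2] with s hs
  exact ⟨ht.1.trans hs.1, hs.2⟩

/-- The absolute value of a right differentiable function is right differentiable. -/
lemma HasDerivWithinAt.exists_sign_abs {f : ℝ → ℝ} {f' t : ℝ}
    (h : HasDerivWithinAt f f' (Ici t) t) :
    ∃ s : ℝ, (s = 1 ∨ s = -1) ∧ s * f t = |f t| ∧
      HasDerivWithinAt (fun r => |f r|) (s * f') (Ici t) t := by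
  rcases lt_trichotomy (f t) 0 with h0 | h0 | h0
  · refine ⟨-1, Or.inr rfl, by rw [abs_of_neg h0]; ring, ?_⟩
    have := (hasDerivAt_abs_neg h0).comp_hasDerivWithinAt t h
    simpa [Function.comp_def] using this
  -- At a zero of `f` the right slopes of `|f|` are the absolute values of those of `f`. The sign is
  -- then taken from `f'`, and `s * f t = |f t|` holds because both sides vanish.
  · have key : HasDerivWithinAt (fun r => |f r|) |f'| (Ici t) t := by
      rw [hasDerivWithinAt_iff_tendsto_slope, Ici_sdiff_left] at h ⊢
      refine h.abs.congr' ?_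
      filter_upwards [self_mem_nhdsWithin] with r hr
      have hr' : 0 < r - t := sub_pos.2 hr
      simp [slope_def_field, h0, abs_div, abs_of_pos hr']
    rcases abs_cases f' with ⟨h1, -⟩ | ⟨h1, -⟩
    · exact ⟨1, Or.inl rfl, by simp [h0], by simpa [h1] using key⟩
    · exact ⟨-1, Or.inr rfl, by simp [h0], by simpa [h1] using key⟩
  · refine ⟨1, Or.inl rfl, by rw [abs_of_pos h0]; ring, ?_⟩
    have := (hasDerivAt_abs_pos h0).comp_hasDerivWithinAt t h
    simpa [Function.comp_def] using this

/-! ### Contraction in a weighted `ℓ¹` distance -/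

/-- The infinitesimal form of the contraction estimate, with the signs `s₁`, `s₂` of the
differences made explicit. -/
lemma signed_drift_le {β σ ε η k x₁ y₁ x₂ y₂ s₁ s₂ : ℝ} (hβ : 0 < β) (hσ : 0 < σ)
    (hη : 0 ≤ η) (hy₁ : 0 < y₁) (hx₂ : 0 < x₂) (hy₂ : 0 < y₂)
    (hk₁ : k * (σ + η) * y₁ ≤ β * η) (hk₂ : k * (y₁ * y₂) ≤ ε - η * x₂)
    (hs₁ : s₁ = 1 ∨ s₁ = -1) (hs₂ : s₂ = 1 ∨ s₂ = -1)
    (h₁ : s₁ * (x₁ - x₂) = |x₁ - x₂|) (h₂ : s₂ * (y₁ - y₂) = |y₁ - y₂|) :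
    (σ + η) * (s₁ * (-β * (x₁ / y₁ - x₂ / y₂))) +
      β * (s₂ * (σ * (x₁ / y₁ - x₂ / y₂) + ε * (1 / y₁ - 1 / y₂))) ≤
      -k * ((σ + η) * |x₁ - x₂| + β * |y₁ - y₂|) := by
  obtain ⟨A, hA⟩ : ∃ A, A = 1 / y₁ := ⟨_, rfl⟩
  obtain ⟨B, hB⟩ : ∃ B, B = 1 / (y₁ * y₂) := ⟨_, rfl⟩
  have hApos : 0 < A := by rw [hA]; positivity
  have hBpos : 0 < B := by rw [hB]; positivity
  -- Both coefficients `A` and `B * x₂` are positive, so the interaction between the two components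
  -- is cooperative.
  have hQ : x₁ / y₁ - x₂ / y₂ = A * (x₁ - x₂) - B * x₂ * (y₁ - y₂) := by
    rw [hA, hB]; field_simp; ring
  have hR : 1 / y₁ - 1 / y₂ = -B * (y₁ - y₂) := by
    rw [hB]; field_simp; ring
  have hkA : k * (σ + η) ≤ β * η * A := by
    rw [hA, mul_one_div, le_div_iff₀ hy₁]; exact hk₁
  have hkB : k ≤ (ε - η * x₂) * B := by
    rw [hB, mul_one_div, le_div_iff₀ (by positivity)]; exact hk₂
  rw [hQ, hR]
  have hX := abs_nonneg (x₁ - x₂)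
  have hY := abs_nonneg (y₁ - y₂)
  set X := x₁ - x₂
  set Y := y₁ - y₂
  have e₁ : k * (σ + η) * |X| ≤ β * η * A * |X| := mul_le_mul_of_nonneg_right hkA hX
  have e₂ : β * |Y| * k ≤ β * |Y| * ((ε - η * x₂) * B) :=
    mul_le_mul_of_nonneg_left hkB (by positivity)
  have p₁ : 0 ≤ σ * β * A * |X| := by positivity
  have p₂ : 0 ≤ η * β * A * |X| := by positivity
  have p₃ : 0 ≤ σ * β * B * x₂ * |Y| := by positivity
  have p₄ : 0 ≤ η * β * B * x₂ * |Y| := by positivity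
  -- With equal signs the `σ` terms cancel, leaving `-β η A |X| - β (ε - η x₂) B |Y|`, which `e₁`
  -- and `e₂` bound. Opposite signs only add nonpositive terms.
  rcases hs₁ with rfl | rfl <;> rcases hs₂ with rfl | rfl
  · rw [← h₁] at e₁ ⊢; rw [← h₂] at e₂ ⊢; linarith
  · have a₁ : X = |X| := by linarith
    have a₂ : Y = -|Y| := by linarith
    have : (σ + η) * (1 * (-β * (A * X - B * x₂ * Y))) +
        β * (-1 * (σ * (A * X - B * x₂ * Y) + ε * (-B * Y))) =
        (σ + η) * (1 * (-β * (A * |X| - B * x₂ * -|Y|))) +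
        β * (-1 * (σ * (A * |X| - B * x₂ * -|Y|) + ε * (-B * -|Y|))) := by
      rw [← a₁, ← a₂]
    rw [this]; linarith
  · have a₁ : X = -|X| := by linarith
    have a₂ : Y = |Y| := by linarith
    have : (σ + η) * (-1 * (-β * (A * X - B * x₂ * Y))) +
        β * (1 * (σ * (A * X - B * x₂ * Y) + ε * (-B * Y))) =
        (σ + η) * (-1 * (-β * (A * -|X| - B * x₂ * |Y|))) +
        β * (1 * (σ * (A * -|X| - B * x₂ * |Y|) + ε * (-B * |Y|))) := by
      rw [← a₁, ← a₂]
    rw [this]; linarith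
  · rw [← h₁] at e₁ ⊢; rw [← h₂] at e₂ ⊢; linarith

/-- Two positive solutions approach each other exponentially in a weighted `ℓ¹` distance, at a rate
controlled by upper bounds on the solutions. -/
lemma IsPositiveSolutionOn.weighted_dist_le {α γ : ℝ → ℝ} {β σ ε η k a b : ℝ}
    {x₁ y₁ x₂ y₂ : ℝ → ℝ} (hβ : 0 < β) (hσ : 0 < σ) (hη : 0 ≤ η)
    (h₁ : IsPositiveSolutionOn α γ β σ ε (Icc a b) x₁ y₁)
    (h₂ : IsPositiveSolutionOn α γ β σ ε (Icc a b) x₂ y₂)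
    (hk₁ : ∀ t ∈ Icc a b, k * (σ + η) * y₁ t ≤ β * η)
    (hk₂ : ∀ t ∈ Icc a b, k * (y₁ t * y₂ t) ≤ ε - η * x₂ t) {t : ℝ} (ht : t ∈ Icc a b) :
    (σ + η) * |x₁ t - x₂ t| + β * |y₁ t - y₂ t| ≤
      ((σ + η) * |x₁ a - x₂ a| + β * |y₁ a - y₂ a|) * Real.exp (-k * (t - a)) := by
  have hd : ∀ r ∈ Ico a b, ∃ d : ℝ,
      HasDerivWithinAt (fun r => (σ + η) * |x₁ r - x₂ r| + β * |y₁ r - y₂ r|) d (Ici r) r ∧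
      d ≤ -k * ((σ + η) * |x₁ r - x₂ r| + β * |y₁ r - y₂ r|) := by
    intro r hr
    have hr' := Ico_subset_Icc_self hr
    obtain ⟨s₁, hs₁, e₁, d₁⟩ := (((h₁.deriv_x r hr').sub (h₂.deriv_x r hr')).Ici_of_Icc
      hr).exists_sign_abs
    obtain ⟨s₂, hs₂, e₂, d₂⟩ := (((h₁.deriv_y r hr').sub (h₂.deriv_y r hr')).Ici_of_Icc
      hr).exists_sign_abs
    refine ⟨_, (d₁.const_mul (σ + η)).add (d₂.const_mul β), ?_⟩
    have := signed_drift_le hβ hσ hη (h₁.pos_y r hr') (h₂.pos_x r hr') (h₂.pos_y r hr')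
      (hk₁ r hr') (hk₂ r hr') hs₁ hs₂ e₁ e₂
    refine le_trans (le_of_eq ?_) this
    ring
  have hc : ContinuousOn (fun r => (σ + η) * |x₁ r - x₂ r| + β * |y₁ r - y₂ r|) (Icc a b) :=
    ((h₁.continuousOn_x.sub h₂.continuousOn_x).abs.const_mul _).add
      ((h₁.continuousOn_y.sub h₂.continuousOn_y).abs.const_mul _)
  choose! d hd hd' using hd
  -- This form of Grönwall's inequality needs only right derivatives, which the absolute values have
  -- even at their zeros.
  have := le_gronwallBound_of_liminf_deriv_right_le (f' := d) (K := -k) (ε := 0) hc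
    (fun r hr c hc => (hd r hr).liminf_right_slope_le hc) le_rfl
    (fun r hr => by simpa using hd' r hr) t ht
  rwa [gronwallBound_ε0] at this

/-- With `η = k = 0` the contraction estimate needs no upper bounds on the solutions, so it is
available before any are known. -/
lemma IsPositiveSolutionOn.dist_le {α γ : ℝ → ℝ} {β σ ε a b : ℝ}
    {x₁ y₁ x₂ y₂ : ℝ → ℝ} (hβ : 0 < β) (hσ : 0 < σ) (hε : 0 < ε)
    (h₁ : IsPositiveSolutionOn α γ β σ ε (Icc a b) x₁ y₁)
    (h₂ : IsPositiveSolutionOn α γ β σ ε (Icc a b) x₂ y₂) {t : ℝ} (ht : t ∈ Icc a b) :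
    σ * |x₁ t - x₂ t| + β * |y₁ t - y₂ t| ≤ σ * |x₁ a - x₂ a| + β * |y₁ a - y₂ a| := by
  simpa using h₁.weighted_dist_le (η := 0) (k := 0) hβ hσ le_rfl h₂ (by simp)
    (by simp [hε.le]) ht

lemma eq_and_eq_of_weighted_abs_le {β σ a b c d : ℝ} (hβ : 0 < β) (hσ : 0 < σ)
    (h : σ * |a - b| + β * |c - d| ≤ 0) : a = b ∧ c = d := by
  have h₁ := mul_nonneg hσ.le (abs_nonneg (a - b))
  have h₂ := mul_nonneg hβ.le (abs_nonneg (c - d))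
  constructor
  · have : σ * |a - b| = 0 := by linarith
    simpa [hσ.ne', sub_eq_zero] using this
  · have : β * |c - d| = 0 := by linarith
    simpa [hβ.ne', sub_eq_zero] using this

lemma IsPositiveSolutionOn.eqOn {α γ : ℝ → ℝ} {β σ ε a b : ℝ}
    {x₁ y₁ x₂ y₂ : ℝ → ℝ} (hβ : 0 < β) (hσ : 0 < σ) (hε : 0 < ε)
    (h₁ : IsPositiveSolutionOn α γ β σ ε (Icc a b) x₁ y₁)
    (h₂ : IsPositiveSolutionOn α γ β σ ε (Icc a b) x₂ y₂)
    (hx : x₁ a = x₂ a) (hy : y₁ a = y₂ a) {t : ℝ} (ht : t ∈ Icc a b) :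
    x₁ t = x₂ t ∧ y₁ t = y₂ t := by
  refine eq_and_eq_of_weighted_abs_le hβ hσ ((h₁.dist_le hβ hσ hε h₂ ht).trans ?_)
  simp [hx, hy]

/-! ### Existence of solutions on half-lines -/

/-- A function stays above a level at which its derivative is positive. -/
lemma le_of_deriv_pos_at_level {f f' : ℝ → ℝ} {a b m : ℝ}
    (hf : ∀ t ∈ Icc a b, HasDerivWithinAt f (f' t) (Icc a b) t) (ha : m ≤ f a)
    (h : ∀ t ∈ Icc a b, f t = m → 0 < f' t) : ∀ t ∈ Icc a b, m ≤ f t := by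
  intro t ht
  have := image_le_of_deriv_right_lt_deriv_boundary (f := fun t => -f t) (f' := fun t => -f' t)
    (a := a) (b := b) (B := fun _ => -m) (B' := fun _ => 0)
    (fun t ht => (hf t ht).neg.continuousWithinAt)
    (fun t ht => ((hf t (Ico_subset_Icc_self ht)).Ici_of_Icc ht).neg)
    (neg_le_neg ha) (fun t => hasDerivAt_const t _)
    (fun t ht e => neg_lt_zero.2 (h t (Ico_subset_Icc_self ht) (neg_injective e))) ht
  exact neg_le_neg_iff.1 this

/-- A bounded, globally Lipschitz vector field has solutions on every compact interval. -/
lemma exists_hasDerivWithinAt_Icc_of_bounded_lipschitz {E : Type*} [NormedAddCommGroup E]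
    [NormedSpace ℝ E] [CompleteSpace E] {f : ℝ → E → E} {K L : NNReal} {a b : ℝ} (hab : a ≤ b)
    (hK : ∀ t, LipschitzWith K (f t)) (hc : ∀ z, Continuous fun t => f t z)
    (hL : ∀ t z, ‖f t z‖ ≤ L) (z₀ : E) :
    ∃ z : ℝ → E, z a = z₀ ∧ ∀ t ∈ Icc a b, HasDerivWithinAt z (f t (z t)) (Icc a b) t := by
  -- A curve of speed at most `L` moves by at most `L * (b - a)`, so with this radius the solution
  -- survives up to `b`.
  have h : IsPicardLindelof f (⟨a, le_rfl, hab⟩ : Icc a b) z₀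
      (L * ⟨b - a, sub_nonneg.2 hab⟩) 0 L K :=
    { lipschitzOnWith := fun t _ => (hK t).lipschitzOnWith
      continuousOn := fun z _ => (hc z).continuousOn
      norm_le := fun t _ z _ => hL t z
      mul_max_le := by
        rw [max_eq_left (by simpa using hab)]
        exact (sub_zero _).ge }
  exact h.exists_eq_forall_mem_Icc_hasDerivWithinAt₀

/-- The quotient `x / y` cut off to be bounded and Lipschitz. -/
lemma abs_truncated_div_sub_le {M m x₁ y₁ x₂ y₂ : ℝ} (hM : 0 ≤ M) (hm : 0 < m) :
    |max (min x₁ M) 0 / max y₁ m - max (min x₂ M) 0 / max y₂ m| ≤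
      |x₁ - x₂| / m + M / m ^ 2 * |y₁ - y₂| := by
  have hX : |max (min x₁ M) 0 - max (min x₂ M) 0| ≤ |x₁ - x₂| :=
    (abs_max_sub_max_le_abs _ _ _).trans 
      (by simpa using abs_min_sub_min_le_max x₁ M x₂ M)
  have hY : |max y₁ m - max y₂ m| ≤ |y₁ - y₂| := abs_max_sub_max_le_abs _ _ _
  have hX0 : 0 ≤ max (min x₂ M) 0 := le_max_right _ _
  have hXM : max (min x₂ M) 0 ≤ M := max_le (min_le_right _ _) hM
  have hy₁ : m ≤ max y₁ m := le_max_right _ _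
  have hy₂ : m ≤ max y₂ m := le_max_right _ _
  generalize max (min x₁ M) 0 = X₁ at *
  generalize max (min x₂ M) 0 = X₂ at *
  generalize max y₁ m = Y₁ at *
  generalize max y₂ m = Y₂ at *
  have h₁ : 0 < Y₁ := hm.trans_le hy₁
  have h₂ : 0 < Y₂ := hm.trans_le hy₂
  have e : X₁ / Y₁ - X₂ / Y₂ = (X₁ - X₂) / Y₁ + X₂ / (Y₁ * Y₂) * -(Y₁ - Y₂) := by
    field_simp; ring
  rw [e]
  refine (abs_add_le _ _).trans (add_le_add ?_ ?_)
  · rw [abs_div, abs_of_pos h₁]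
    gcongr
  · rw [abs_mul, abs_neg, abs_of_nonneg (by positivity : 0 ≤ X₂ / (Y₁ * Y₂)), sq]
    gcongr

/-- The vector field is singular at `y = 0`, so a truncated one is solved and the truncation is
shown to be inactive. At `y = m` the term `ε / m ≥ 2 A` outweighs `γ`; at `x = n` with `y ≥ m` the
loss `β x / y` is at most `c / 2`, below `α`; and `x' ≤ A` gives the upper bound `M`. Only `M`
depends on `b`: the lower bounds `n` and `m` survive on the half-line. -/
lemma exists_isPositiveSolutionOn_Icc {α γ : ℝ → ℝ} {β σ ε c A m n u₀ v₀ a b : ℝ}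
    (hβ : 0 < β) (hσ : 0 < σ) (hε : 0 < ε) (hαc : Continuous α) (hγc : Continuous γ)
    (hc : 0 < c) (hα : ∀ t, c ≤ α t) (hαA : ∀ t, α t ≤ A) (hA : 0 < A)
    (hγ0 : ∀ t, 0 < γ t) (hγ : ∀ t, γ t ≤ A) (hm : 0 < m) (hmv : m ≤ v₀) (hmA : m * (2 * A) ≤ ε)
    (hn : 0 < n) (hnu : n ≤ u₀) (hnm : n * (2 * β) ≤ c * m) (hab : a ≤ b) :
    ∃ x y : ℝ → ℝ, IsPositiveSolutionOn α γ β σ ε (Icc a b) x y ∧ x a = u₀ ∧ y a = v₀ ∧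
      ∀ t ∈ Icc a b, n ≤ x t ∧ m ≤ y t := by
  obtain ⟨M, hMdef⟩ : ∃ M, M = u₀ + A * (b - a) := ⟨_, rfl⟩
  have hM0 : 0 ≤ A * (b - a) := mul_nonneg hA.le (sub_nonneg.2 hab)
  have hM : 0 ≤ M := by linarith
  let q : ℝ × ℝ → ℝ := fun z => max (min z.1 M) 0 / max z.2 m
  let r : ℝ × ℝ → ℝ := fun z => 1 / max z.2 m
  have hq0 : ∀ z, 0 ≤ q z := fun z => div_nonneg (le_max_right _ _) (hm.le.trans (le_max_right _ _))
  have hqM : ∀ z, q z ≤ M / m := fun z =>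
    div_le_div₀ hM (max_le (min_le_right _ _) hM) hm (le_max_right _ _)
  have hr0 : ∀ z, 0 ≤ r z := fun z => div_nonneg zero_le_one (hm.le.trans (le_max_right _ _))
  have hrm : ∀ z, r z ≤ 1 / m := fun z => div_le_div₀ zero_le_one le_rfl hm (le_max_right _ _)
  have hqL : ∀ z w, |q z - q w| ≤ (1 / m + M / m ^ 2) * ‖z - w‖ := by
    intro z w
    have h₁ : |z.1 - w.1| ≤ ‖z - w‖ := norm_fst_le (z - w)
    have h₂ : |z.2 - w.2| ≤ ‖z - w‖ := norm_snd_le (z - w)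
    refine (abs_truncated_div_sub_le hM hm).trans ?_
    rw [add_mul, one_div_mul_eq_div]
    gcongr
  have hrL : ∀ z w, |r z - r w| ≤ 1 / m ^ 2 * ‖z - w‖ := by
    intro z w
    have h₂ : |z.2 - w.2| ≤ ‖z - w‖ := norm_snd_le (z - w)
    have := abs_truncated_div_sub_le (x₁ := 1) (x₂ := 1) (y₁ := z.2) (y₂ := w.2) zero_le_one hm
    simp only [min_self, sub_self, abs_zero, zero_div, zero_add,
      max_eq_left (zero_le_one' ℝ)] at this
    exact this.trans (by gcongr)
  obtain ⟨K, hK⟩ : ∃ K, K = (β + σ) * (1 / m + M / m ^ 2) + ε * (1 / m ^ 2) := ⟨_, rfl⟩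
  have hK0 : 0 ≤ K := by rw [hK]; positivity
  obtain ⟨L, hL⟩ : ∃ L, L = A + (β + σ) * (M / m) + ε * (1 / m) := ⟨_, rfl⟩
  have hL0 : 0 ≤ L := by rw [hL]; positivity
  let f : ℝ → ℝ × ℝ → ℝ × ℝ := fun t z => (α t - β * q z, -γ t + σ * q z + ε * r z)
  have hfK : ∀ t, LipschitzWith ⟨K, hK0⟩ (f t) := by
    refine fun t => LipschitzWith.of_dist_le_mul fun z w => ?_
    rw [dist_eq_norm z w, Prod.dist_eq, Real.dist_eq, Real.dist_eq]
    have hN := norm_nonneg (z - w)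
    have h₁ := hqL z w
    have h₂ := hrL z w
    have p₁ : 0 ≤ β * ((1 / m + M / m ^ 2) * ‖z - w‖) := by positivity
    have p₂ : 0 ≤ σ * ((1 / m + M / m ^ 2) * ‖z - w‖) := by positivity
    have p₃ : 0 ≤ ε * (1 / m ^ 2 * ‖z - w‖) := by positivity
    have eK : K * ‖z - w‖ = β * ((1 / m + M / m ^ 2) * ‖z - w‖) +
      σ * ((1 / m + M / m ^ 2) * ‖z - w‖) + ε * (1 / m ^ 2 * ‖z - w‖) := by rw [hK]; ring
    change max |(α t - β * q z) - (α t - β * q w)|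
      |(-γ t + σ * q z + ε * r z) - (-γ t + σ * q w + ε * r w)| ≤ K * ‖z - w‖
    refine max_le ?_ ?_
    · rw [show (α t - β * q z) - (α t - β * q w) = β * -(q z - q w) by ring, abs_mul, abs_neg,
        abs_of_pos hβ]
      linarith [mul_le_mul_of_nonneg_left h₁ hβ.le]
    · rw [show (-γ t + σ * q z + ε * r z) - (-γ t + σ * q w + ε * r w) =
        σ * (q z - q w) + ε * (r z - r w) by ring]
      refine (abs_add_le _ _).trans ?_
      rw [abs_mul, abs_mul, abs_of_pos hσ, abs_of_pos hε]
      linarith [mul_le_mul_of_nonneg_left h₁ hσ.le, mul_le_mul_of_nonneg_left h₂ hε.le]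
  have hfc : ∀ z, Continuous fun t => f t z := fun z => by fun_prop
  have hfL : ∀ t z, ‖f t z‖ ≤ (⟨L, hL0⟩ : NNReal) := by
    intro t z
    change max |α t - β * q z| |-γ t + σ * q z + ε * r z| ≤ L
    have b₁ := mul_nonneg hβ.le (hq0 z)
    have b₂ := mul_le_mul_of_nonneg_left (hqM z) hβ.le
    have b₃ := mul_nonneg hσ.le (hq0 z)
    have b₄ := mul_le_mul_of_nonneg_left (hqM z) hσ.le
    have b₅ := mul_nonneg hε.le (hr0 z)
    have b₆ := mul_le_mul_of_nonneg_left (hrm z) hε.le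
    have := hα t; have := hαA t; have := hγ0 t; have := hγ t
    refine max_le (abs_le.2 ⟨?_, ?_⟩) (abs_le.2 ⟨?_, ?_⟩) <;> linarith
  obtain ⟨z, hz0, hz⟩ := exists_hasDerivWithinAt_Icc_of_bounded_lipschitz hab hfK hfc hfL (u₀, v₀)
  have hx : ∀ t ∈ Icc a b,
      HasDerivWithinAt (fun t => (z t).1) (α t - β * q (z t)) (Icc a b) t := fun t ht =>
    (ContinuousLinearMap.fst ℝ ℝ ℝ).hasFDerivAt.comp_hasDerivWithinAt t (hz t ht)
  have hy : ∀ t ∈ Icc a b,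
      HasDerivWithinAt (fun t => (z t).2) (-γ t + σ * q (z t) + ε * r (z t)) (Icc a b) t :=
    fun t ht => (ContinuousLinearMap.snd ℝ ℝ ℝ).hasFDerivAt.comp_hasDerivWithinAt t (hz t ht)
  have hylow : ∀ t ∈ Icc a b, m ≤ (z t).2 := by
    refine le_of_deriv_pos_at_level hy (by rw [hz0]; exact hmv) fun t _ e => ?_
    have h₁ : ε * r (z t) = ε / m := by simp only [r, e, max_self, mul_one_div]
    have h₂ : 2 * A ≤ ε / m := by rw [le_div_iff₀ hm]; linarith
    have := mul_nonneg hσ.le (hq0 (z t))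
    linarith [hγ t]
  have hxlow : ∀ t ∈ Icc a b, n ≤ (z t).1 := by
    refine le_of_deriv_pos_at_level hx (by rw [hz0]; exact hnu) fun t ht e => ?_
    have h₁ : q (z t) = n / (z t).2 := by
      simp only [q, e, max_eq_left (hylow t ht), min_eq_left (show n ≤ M by linarith),
        max_eq_left hn.le]
    have h₂ : β * q (z t) ≤ c / 2 := by
      rw [h₁, mul_div_assoc', div_le_iff₀ (hm.trans_le (hylow t ht))]
      nlinarith [hylow t ht]
    linarith [hα t]
  have hxup : ∀ t ∈ Icc a b, (z t).1 ≤ M := by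
    intro t ht
    have h₁ := image_le_of_deriv_right_le_deriv_boundary
      (fun s hs => (hx s hs).continuousWithinAt)
      (fun s hs => (hx s (Ico_subset_Icc_self hs)).Ici_of_Icc hs)
      (B := fun s => u₀ + A * (s - a)) (B' := fun _ => A) (by simp [hz0])
      (by fun_prop)
      (fun s _ => by simpa using (((hasDerivWithinAt_id s _).sub_const a).const_mul A).const_add u₀)
      (fun s _ => by linarith [hαA s, mul_nonneg hβ.le (hq0 (z s))]) ht
    refine h₁.trans ?_
    rw [hMdef]
    have := ht.2
    gcongr
  have hq : ∀ t ∈ Icc a b, q (z t) = (z t).1 / (z t).2 := fun t ht => by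
    simp only [q, max_eq_left (hylow t ht), min_eq_left (hxup t ht),
      max_eq_left (hn.le.trans (hxlow t ht))]
  have hr : ∀ t ∈ Icc a b, ε * r (z t) = ε / (z t).2 := fun t ht => by
    simp only [r, max_eq_left (hylow t ht), mul_one_div]
  refine ⟨fun t => (z t).1, fun t => (z t).2, ⟨fun t ht => hn.trans_le (hxlow t ht),
    fun t ht => hm.trans_le (hylow t ht), fun t ht => ?_, fun t ht => ?_⟩, by simp [hz0],
    by simp [hz0], fun t ht => ⟨hxlow t ht, hylow t ht⟩⟩
  · simpa only [hq t ht] using hx t ht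
  · simpa only [hq t ht, hr t ht] using hy t ht

/-- Solutions on growing compact intervals patch together to a solution on a half-line. -/
lemma exists_isPositiveSolutionOn_Ici_of_Icc {α γ : ℝ → ℝ} {β σ ε m n u₀ v₀ a : ℝ}
    (hβ : 0 < β) (hσ : 0 < σ) (hε : 0 < ε)
    (h : ∀ b, a ≤ b → ∃ x y : ℝ → ℝ, IsPositiveSolutionOn α γ β σ ε (Icc a b) x y ∧
      x a = u₀ ∧ y a = v₀ ∧ ∀ t ∈ Icc a b, n ≤ x t ∧ m ≤ y t) :
    ∃ x y : ℝ → ℝ, IsPositiveSolutionOn α γ β σ ε (Ici a) x y ∧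
      x a = u₀ ∧ y a = v₀ ∧ ∀ t ∈ Ici a, n ≤ x t ∧ m ≤ y t := by
  choose! X Y hsol hX hY hlow using h
  have hab : ∀ t ∈ Ici a, a ≤ t + 1 := fun t ht => by have := mem_Ici.1 ht; linarith
  have key : ∀ b, a ≤ b → ∀ t ∈ Icc a b, X (t + 1) t = X b t ∧ Y (t + 1) t = Y b t := by
    intro b hb t ht
    have hb' := hab t ht.1
    have s₁ := (hsol _ hb').mono (Icc_subset_Icc_right (by linarith) : Icc a t ⊆ Icc a (t + 1))
    have s₂ := (hsol _ hb).mono (Icc_subset_Icc_right ht.2 : Icc a t ⊆ Icc a b)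
    exact s₁.eqOn hβ hσ hε s₂ (by rw [hX _ hb', hX _ hb]) (by rw [hY _ hb', hY _ hb])
      ⟨ht.1, le_rfl⟩
  have hmem : ∀ t ∈ Ici a, t ∈ Icc a (t + 1) := fun t ht => ⟨ht, by linarith⟩
  have hev : ∀ t ∈ Ici a, Icc a (t + 1) ∈ 𝓝[Ici a] t := by
    intro t _
    filter_upwards [self_mem_nhdsWithin, mem_nhdsWithin_of_mem_nhds (Iic_mem_nhds (lt_add_one t))]
      with s h₁ h₂ using ⟨h₁, h₂⟩
  -- Using the solution on `[a, t + 1]` rather than `[a, t]` makes the interval a neighbourhood of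
  -- `t` in `Ici a`, on which the patched function agrees with a single solution.
  refine ⟨fun t => X (t + 1) t, fun t => Y (t + 1) t,
    ⟨fun t ht => (hsol _ (hab t ht)).pos_x t (hmem t ht),
      fun t ht => (hsol _ (hab t ht)).pos_y t (hmem t ht), fun t ht => ?_, fun t ht => ?_⟩,
    hX _ (by linarith), hY _ (by linarith), fun t ht => hlow _ (hab t ht) t (hmem t ht)⟩
  · refine (((hsol _ (hab t ht)).deriv_x t (hmem t ht)).mono_of_mem_nhdsWithin
      (hev t ht)).congr_of_eventuallyEq ?_ rfl
    filter_upwards [hev t ht] with s hs using (key _ (hab t ht) s hs).1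
  · refine (((hsol _ (hab t ht)).deriv_y t (hmem t ht)).mono_of_mem_nhdsWithin
      (hev t ht)).congr_of_eventuallyEq ?_ rfl
    filter_upwards [hev t ht] with s hs using (key _ (hab t ht) s hs).2

/-- Every positive initial value is attained by a positive solution on the half-line, and this
solution stays away from the coordinate axes. -/
lemma exists_isPositiveSolutionOn_Ici {α γ : ℝ → ℝ} {β σ ε c A u₀ v₀ : ℝ}
    (hβ : 0 < β) (hσ : 0 < σ) (hε : 0 < ε) (hαc : Continuous α) (hγc : Continuous γ)
    (hc : 0 < c) (hα : ∀ t, c ≤ α t) (hαA : ∀ t, α t ≤ A)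
    (hγ0 : ∀ t, 0 < γ t) (hγ : ∀ t, γ t ≤ A) (hu₀ : 0 < u₀) (hv₀ : 0 < v₀) (a : ℝ) :
    ∃ x y : ℝ → ℝ, IsPositiveSolutionOn α γ β σ ε (Ici a) x y ∧ x a = u₀ ∧ y a = v₀ ∧
      ∃ m > 0, ∀ t ∈ Ici a, m ≤ x t ∧ m ≤ y t := by
  have hA : 0 < A := (hγ0 0).trans_le (hγ 0)
  obtain ⟨m, hm⟩ : ∃ m, m = min v₀ (ε / (2 * A)) := ⟨_, rfl⟩
  have hm0 : 0 < m := hm ▸ lt_min hv₀ (by positivity)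
  have hmA : m * (2 * A) ≤ ε := by
    rw [← le_div_iff₀ (by positivity), hm]; exact min_le_right _ _
  obtain ⟨n, hn⟩ : ∃ n, n = min u₀ (c * m / (2 * β)) := ⟨_, rfl⟩
  have hn0 : 0 < n := hn ▸ lt_min hu₀ (by positivity)
  have hnA : n * (2 * β) ≤ c * m := by
    rw [← le_div_iff₀ (by positivity), hn]; exact min_le_right _ _
  obtain ⟨x, y, h, hx, hy, hlow⟩ := exists_isPositiveSolutionOn_Ici_of_Icc hβ hσ hε fun b hb =>
    exists_isPositiveSolutionOn_Icc hβ hσ hε hαc hγc hc hα hαA hA hγ0 hγ hm0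
      (hm ▸ min_le_left _ _) hmA hn0 (hn ▸ min_le_left _ _) hnA hb
  exact ⟨x, y, h, hx, hy, min n m, lt_min hn0 hm0, fun t ht =>
    ⟨(min_le_left _ _).trans (hlow t ht).1, (min_le_right _ _).trans (hlow t ht).2⟩⟩

/-! ### Upper bounds from a Lyapunov function -/

/-- The left side is the derivative of the Lyapunov function `H` in `exists_upper_bound`. When `σ x
+ β y` is large, either `y ≥ K`, and `-δ` beats the remaining terms, of order `1 / y`; or `y ≤ K`,
so `x` is large and the term with `σ x / y` absorbs `β ε / y`, however small `y` is. -/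
lemma lyapunov_drift_neg {β σ ε δ A K x y g : ℝ} (hβ : 0 < β) (hσ : 0 < σ) (hε : 0 < ε)
    (hδ : 0 < δ) (hA : 0 < A) (hg : g ≤ A) (hK : 2 * (β * ε + A) ≤ δ * K) (hx : 0 < x) (hy : 0 < y)
    (hw : β * K + β * ε * (1 + K) ^ 2 + A * K ≤ σ * x + β * y) :
    -δ + β * (ε / y) - (-g + σ * (x / y) + ε / y) / (1 + y) ^ 2 < 0 := by
  have e : -δ + β * (ε / y) - (-g + σ * (x / y) + ε / y) / (1 + y) ^ 2 =
      (-δ * (y * (1 + y) ^ 2) + β * ε * (1 + y) ^ 2 + g * y - σ * x - ε) / (y * (1 + y) ^ 2) := by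
    field_simp; ring
  have hβε : 0 < β * ε := mul_pos hβ hε
  have hgy : g * y ≤ A * y := mul_le_mul_of_nonneg_right hg hy.le
  have hσx : 0 < σ * x := mul_pos hσ hx
  rw [e]
  refine div_neg_of_neg_of_pos ?_ (by positivity)
  have hsq : 0 < (1 + y) ^ 2 := by positivity
  rcases le_total K y with h | h
  · have h₁ : 2 * (β * ε + A) ≤ δ * y := hK.trans (mul_le_mul_of_nonneg_left h hδ.le)
    have h₂ : 2 * (β * ε + A) * (1 + y) ^ 2 ≤ δ * y * (1 + y) ^ 2 :=
      mul_le_mul_of_nonneg_right h₁ hsq.le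
    have h₃ : A * y ≤ A * (1 + y) ^ 2 := by
      gcongr; nlinarith
    have h₄ : 0 < β * ε * (1 + y) ^ 2 := by positivity
    have h₅ : 0 < A * (1 + y) ^ 2 := by positivity
    linarith
  · have h₁ : β * ε * (1 + y) ^ 2 ≤ β * ε * (1 + K) ^ 2 := by gcongr
    have h₂ : A * y ≤ A * K := by gcongr
    have h₃ : β * y ≤ β * K := by gcongr
    have h₄ : 0 < δ * (y * (1 + y) ^ 2) := by positivity
    linarith

/-- The primitive of a continuous periodic function with vanishing integral over a period
is bounded. -/
lemma exists_abs_primitive_le {g : ℝ → ℝ} {p : ℝ} (hp : 0 < p) (hg : Continuous g)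
    (hgp : Function.Periodic g p) (h0 : ∫ t in (0 : ℝ)..p, g t = 0) :
    ∃ C, ∀ t, |∫ s in (0 : ℝ)..t, g s| ≤ C := by
  have hper : Function.Periodic (fun t => ∫ s in (0 : ℝ)..t, g s) p := by
    intro t
    change ∫ s in (0 : ℝ)..(t + p), g s = ∫ s in (0 : ℝ)..t, g s
    have h₁ := hgp.intervalIntegral_add_eq t 0
    rw [zero_add, h0] at h₁
    rw [← intervalIntegral.integral_add_adjacent_intervals (hg.intervalIntegrable 0 t)
      (hg.intervalIntegrable t (t + p)), h₁, add_zero]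
  have hc : Continuous (fun t => ∫ s in (0 : ℝ)..t, g s) :=
    intervalIntegral.continuous_primitive (fun a b => hg.intervalIntegrable a b) 0
  obtain ⟨C, hC⟩ := (hper.isBounded_of_continuous hp.ne' hc).exists_norm_le
  exact ⟨C, fun t => hC _ (mem_range_self t)⟩

/-- Positive solutions are bounded when the mean value condition holds. -/
lemma IsPositiveSolutionOn.exists_upper_bound {α γ : ℝ → ℝ} {p β σ ε A a : ℝ} {x y : ℝ → ℝ}
    (hp : 0 < p) (hβ : 0 < β) (hσ : 0 < σ) (hε : 0 < ε) (hαc : Continuous α) (hγc : Continuous γ)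
    (hαp : Function.Periodic α p) (hγp : Function.Periodic γ p) (hA : 0 < A) (hγ : ∀ t, γ t ≤ A)
    (hδ : 0 < β * meanValue p γ - σ * meanValue p α)
    (h : IsPositiveSolutionOn α γ β σ ε (Ici a) x y) :
    ∃ M > 0, ∀ t ∈ Ici a, x t ≤ M ∧ y t ≤ M := by
  obtain ⟨δ, hδdef⟩ : ∃ δ, δ = β * meanValue p γ - σ * meanValue p α := ⟨_, rfl⟩
  rw [← hδdef] at hδ
  -- Adding `δ` makes the mean of `g` zero, so its primitive `G` is bounded and can be subtracted at
  -- bounded cost.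
  let g : ℝ → ℝ := fun t => σ * α t - β * γ t + δ
  have hg : Continuous g := by fun_prop
  have hgp : Function.Periodic g p := fun t => by simp only [g, hαp t, hγp t]
  have h0 : ∫ t in (0 : ℝ)..p, g t = 0 := by
    have i₁ : IntervalIntegrable (fun t => σ * α t) MeasureTheory.volume 0 p :=
      (by fun_prop : Continuous fun t => σ * α t).intervalIntegrable _ _
    have i₂ : IntervalIntegrable (fun t => β * γ t) MeasureTheory.volume 0 p :=
      (by fun_prop : Continuous fun t => β * γ t).intervalIntegrable _ _
    simp only [g]
    rw [intervalIntegral.integral_add (i₁.sub i₂) (by simp), intervalIntegral.integral_sub i₁ i₂,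
      intervalIntegral.integral_const_mul, intervalIntegral.integral_const_mul,
      intervalIntegral.integral_const, hδdef, meanValue, meanValue, smul_eq_mul]
    field_simp
    ring
  obtain ⟨C, hC⟩ := exists_abs_primitive_le hp hg hgp h0
  let G : ℝ → ℝ := fun t => ∫ s in (0 : ℝ)..t, g s
  have hG : ∀ t, HasDerivAt G (g t) t := fun t =>
    intervalIntegral.integral_hasDerivAt_right (hg.intervalIntegrable _ _)
      (hg.stronglyMeasurableAtFilter _ _) hg.continuousAt
  obtain ⟨K, hKdef⟩ : ∃ K, K = 2 * (β * ε + A) / δ := ⟨_, rfl⟩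
  have hK : 2 * (β * ε + A) ≤ δ * K := by rw [hKdef, mul_div_cancel₀ _ hδ.ne']
  -- The correction `y / (1 + y)` lies between 0 and 1, yet its derivative `y' / (1 + y) ^ 2`
  -- controls `β ε / y` near `y = 0`.
  let H : ℝ → ℝ := fun t => σ * x t + β * y t - G t - y t / (1 + y t)
  -- Where `H = R`, the bound `|G| ≤ C` gives `σ x + β y ≥ R - C`, which is the threshold of
  -- `lyapunov_drift_neg`; hence `H` cannot cross `R` upwards.
  obtain ⟨R, hR⟩ : ∃ R, R = max (H a) (C + β * K + β * ε * (1 + K) ^ 2 + A * K) := ⟨_, rfl⟩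
  have hH : ∀ t ∈ Ici a, H t ≤ R := by
    intro t ht
    have h' := h.mono (Icc_subset_Ici_self : Icc a t ⊆ Ici a)
    have := le_of_deriv_pos_at_level (f := fun t => -H t) (a := a) (b := t) (m := -R)
      (f' := fun s => -(-δ + β * (ε / y s) -
        (-γ s + σ * (x s / y s) + ε / y s) / (1 + y s) ^ 2)) ?_
      (neg_le_neg (hR ▸ le_max_left _ _)) ?_ t ⟨ht, le_rfl⟩
    · exact neg_le_neg_iff.1 this
    · intro s hs
      have hy := h'.pos_y s hs
      have dx := (h'.deriv_x s hs).const_mul σ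
      have dy := (h'.deriv_y s hs).const_mul β
      have dq := (h'.deriv_y s hs).div ((h'.deriv_y s hs).const_add 1) (by positivity)
      refine ((((dx.add dy).sub (hG s).hasDerivWithinAt).sub dq).neg).congr_deriv ?_
      simp only [g]
      field_simp
      ring
    · intro s hs e
      have hHs : H s = R := neg_injective e
      have hy := h'.pos_y s hs
      refine neg_pos.2 (lyapunov_drift_neg hβ hσ hε hδ hA (hγ s) hK (h'.pos_x s hs) hy ?_)
      have h₁ : C + β * K + β * ε * (1 + K) ^ 2 + A * K ≤ R := hR ▸ le_max_right _ _
      have h₂ : 0 ≤ y s / (1 + y s) := by positivity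
      have h₃ := neg_le_of_abs_le (hC s)
      simp only [H, G] at hHs
      linarith
  have hw : ∀ t ∈ Ici a, σ * x t + β * y t ≤ R + C + 1 := by
    intro t ht
    have hy := h.pos_y t ht
    have h₁ : y t / (1 + y t) ≤ 1 := by rw [div_le_one (by positivity)]; linarith
    have h₂ := le_of_abs_le (hC t)
    have h₃ := hH t ht
    simp only [H, G] at h₃
    linarith
  have hR0 : 0 < R + C + 1 := by
    have h₁ := mul_pos hσ (h.pos_x a self_mem_Ici)
    have h₂ := mul_pos hβ (h.pos_y a self_mem_Ici)
    linarith [hw a self_mem_Ici]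
  refine ⟨max ((R + C + 1) / σ) ((R + C + 1) / β), lt_max_of_lt_left (by positivity),
    fun t ht => ⟨le_max_of_le_left ?_, le_max_of_le_right ?_⟩⟩
  · rw [le_div_iff₀ hσ]; linarith [hw t ht, mul_pos hβ (h.pos_y t ht)]
  · rw [le_div_iff₀ hβ]; linarith [hw t ht, mul_pos hσ (h.pos_x t ht)]

/-! ### Translation in time and exponential attraction -/

lemma IsPositiveSolutionOn.comp_add_const {α γ : ℝ → ℝ} {β σ ε c : ℝ} {J K : Set ℝ}
    {x y : ℝ → ℝ} (h : IsPositiveSolutionOn α γ β σ ε J x y) (hα : Function.Periodic α c)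
    (hγ : Function.Periodic γ c) (hK : MapsTo (· + c) K J) :
    IsPositiveSolutionOn α γ β σ ε K (fun t => x (t + c)) (fun t => y (t + c)) where
  pos_x t ht := h.pos_x _ (hK ht)
  pos_y t ht := h.pos_y _ (hK ht)
  deriv_x t ht := by
    have := (h.deriv_x _ (hK ht)).comp t ((hasDerivWithinAt_id t K).add_const c) hK
    rw [hα t, mul_one] at this
    exact this
  deriv_y t ht := by
    have := (h.deriv_y _ (hK ht)).comp t ((hasDerivWithinAt_id t K).add_const c) hK
    rw [hγ t, mul_one] at this
    exact this

/-- Two bounded positive solutions on a half-line approach each other exponentially. -/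
lemma IsPositiveSolutionOn.exists_exp_dist_le {α γ : ℝ → ℝ} {β σ ε M a : ℝ}
    {x₁ y₁ x₂ y₂ : ℝ → ℝ} (hβ : 0 < β) (hσ : 0 < σ) (hε : 0 < ε) (hM : 0 < M)
    (h₁ : IsPositiveSolutionOn α γ β σ ε (Ici a) x₁ y₁)
    (h₂ : IsPositiveSolutionOn α γ β σ ε (Ici a) x₂ y₂)
    (hy₁ : ∀ t ∈ Ici a, y₁ t ≤ M) (hx₂ : ∀ t ∈ Ici a, x₂ t ≤ M) (hy₂ : ∀ t ∈ Ici a, y₂ t ≤ M) :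
    ∃ C k : ℝ, 0 < k ∧ ∀ t ∈ Ici a, |x₁ t - x₂ t| ≤ C * Real.exp (-k * (t - a)) ∧
      |y₁ t - y₂ t| ≤ C * Real.exp (-k * (t - a)) := by
  -- This `η` uses up at most half of `ε` in `ε - η x₂`. The rate `k` is then the smaller of those
  -- allowed by the two components.
  obtain ⟨η, hη⟩ : ∃ η, η = ε / (2 * M) := ⟨_, rfl⟩
  have hη0 : 0 < η := by rw [hη]; positivity
  have hηM : η * M = ε / 2 := by rw [hη]; field_simp
  obtain ⟨k, hk⟩ : ∃ k, k = min (β * η / ((σ + η) * M)) (ε / (2 * M ^ 2)) := ⟨_, rfl⟩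
  have hk0 : 0 < k := by rw [hk]; exact lt_min (by positivity) (by positivity)
  have hk₁ : k * ((σ + η) * M) ≤ β * η := by
    rw [← le_div_iff₀ (by positivity), hk]; exact min_le_left _ _
  have hk₂ : k * (2 * M ^ 2) ≤ ε := by
    rw [← le_div_iff₀ (by positivity), hk]; exact min_le_right _ _
  obtain ⟨D, hD⟩ : ∃ D, D = (σ + η) * |x₁ a - x₂ a| + β * |y₁ a - y₂ a| := ⟨_, rfl⟩
  have hD0 : 0 ≤ D := by rw [hD]; positivity
  have key : ∀ t ∈ Ici a, (σ + η) * |x₁ t - x₂ t| + β * |y₁ t - y₂ t| ≤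
      D * Real.exp (-k * (t - a)) := by
    intro t ht
    rw [hD]
    refine (h₁.mono Icc_subset_Ici_self).weighted_dist_le hβ hσ hη0.le (h₂.mono Icc_subset_Ici_self)
      (fun s hs => ?_) (fun s hs => ?_) ⟨ht, le_rfl⟩
    · calc k * (σ + η) * y₁ s ≤ k * (σ + η) * M := by
            have := hy₁ s hs.1
            gcongr
        _ ≤ β * η := by linarith
    · have e₁ : y₁ s * y₂ s ≤ M * M :=
        mul_le_mul (hy₁ s hs.1) (hy₂ s hs.1) (h₂.pos_y s hs.1).le hM.le
      have e₂ := mul_le_mul_of_nonneg_left e₁ hk0.le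
      have e₃ := mul_le_mul_of_nonneg_left (hx₂ s hs.1) hη0.le
      linarith
  refine ⟨D / (σ + η) + D / β, k, hk0, fun t ht => ?_⟩
  have e₁ : |x₁ t - x₂ t| ≤ D * Real.exp (-k * (t - a)) / (σ + η) := by
    rw [le_div_iff₀ (by positivity)]
    linarith [key t ht, mul_nonneg hβ.le (abs_nonneg (y₁ t - y₂ t))]
  have e₂ : |y₁ t - y₂ t| ≤ D * Real.exp (-k * (t - a)) / β := by
    rw [le_div_iff₀ hβ]
    linarith [key t ht, mul_nonneg (add_pos hσ hη0).le (abs_nonneg (x₁ t - x₂ t))]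
  have p₁ : 0 ≤ D * Real.exp (-k * (t - a)) / (σ + η) := by positivity
  have p₂ : 0 ≤ D * Real.exp (-k * (t - a)) / β := by positivity
  have : (D / (σ + η) + D / β) * Real.exp (-k * (t - a)) =
      D * Real.exp (-k * (t - a)) / (σ + η) + D * Real.exp (-k * (t - a)) / β := by ring
  constructor <;> linarith

lemma tendsto_sub_zero_of_exp_bound {f : ℝ → ℝ} {C k a : ℝ} (hk : 0 < k)
    (h : ∀ t ∈ Ici a, |f t| ≤ C * Real.exp (-k * (t - a))) : Tendsto f atTop (𝓝 0) := by
  have hlim : Tendsto (fun t : ℝ => C * Real.exp (-k * (t - a))) atTop (𝓝 0) := by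
    have h₁ : Tendsto (fun t : ℝ => -k * (t - a)) atTop atBot :=
      (tendsto_atTop_add_const_right atTop (-a) tendsto_id).const_mul_atTop_of_neg (neg_lt_zero.2 hk)
    simpa using (Real.tendsto_exp_atBot.comp h₁).const_mul C
  refine squeeze_zero_norm' ?_ hlim
  filter_upwards [Ici_mem_atTop a] with t ht using h t ht

lemma cauchySeq_of_exp_bound {f : ℝ → ℝ} {C k p : ℝ} (hk : 0 < k) (hp : 0 < p)
    (h : ∀ t ∈ Ici (0 : ℝ), |f (t + p) - f t| ≤ C * Real.exp (-k * t)) :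
    CauchySeq fun n : ℕ => f (n * p) := by
  refine cauchySeq_of_le_geometric (Real.exp (-k * p)) C
    (Real.exp_lt_one_iff.2 (by nlinarith)) fun n => ?_
  have := h (n * p) (by simp only [mem_Ici]; positivity)
  rw [dist_comm, Real.dist_eq, ← Real.exp_nat_mul]
  push_cast
  rw [add_one_mul]
  refine this.trans_eq ?_
  congr 2
  ring

/-! ### Periodic extension and comparison of periodic functions -/

/-- A positive solution on `[0, ∞)` which is periodic there extends to the whole line. -/
lemma IsPositiveSolutionOn.exists_periodic_extension {α γ : ℝ → ℝ} {β σ ε p : ℝ} {x y : ℝ → ℝ}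
    (hp : 0 < p) (hα : Function.Periodic α p) (hγ : Function.Periodic γ p)
    (h : IsPositiveSolutionOn α γ β σ ε (Ici 0) x y)
    (hx : ∀ t ∈ Ici (0 : ℝ), x (t + p) = x t) (hy : ∀ t ∈ Ici (0 : ℝ), y (t + p) = y t) :
    ∃ u v : ℝ → ℝ, IsPositivePeriodicSolution α γ β σ ε p u v := by
  have key : ∀ f : ℝ → ℝ, (∀ t ∈ Ici (0 : ℝ), f (t + p) = f t) → ∀ (t : ℝ) (N : ℕ),
      0 ≤ t + N * p → f (toIcoMod hp 0 t) = f (t + N * p) := by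
    intro f hf t N ht
    have hN : ∀ n : ℕ, ∀ s ∈ Ici (0 : ℝ), f (s + n * p) = f s := by
      intro n
      induction n with
      | zero => simp
      | succ n ih =>
        intro s hs
        have hs' : s + n * p ∈ Ici (0 : ℝ) := by
          have := mem_Ici.1 hs
          simp only [mem_Ici]; positivity
        rw [← ih s hs, ← hf _ hs']
        congr 1; push_cast; ring
    have hmem := toIcoMod_mem_Ico' hp t
    have hd : (toIcoMod hp 0 t) + (toIcoDiv hp 0 t) * p = t := by
      rw [← zsmul_eq_mul, toIcoMod_add_toIcoDiv_zsmul]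
    have hnn : 0 ≤ toIcoDiv hp 0 t + N := by
      by_contra! hlt
      have h₁ : (toIcoDiv hp 0 t : ℝ) + N ≤ -1 := by exact_mod_cast Int.le_sub_one_of_lt hlt
      nlinarith [hmem.2]
    obtain ⟨n, hn⟩ := Int.eq_ofNat_of_zero_le hnn
    have hn' : (toIcoDiv hp 0 t : ℝ) + N = n := by exact_mod_cast hn
    rw [← hN n _ hmem.1]
    congr 1
    rw [← hn']
    linarith
  -- On `[-N p, ∞)` the extension is the translate of the given solution by `N` periods, hence
  -- itself a solution.
  have hshift : ∀ N : ℕ, IsPositiveSolutionOn α γ β σ ε (Ici (-(N * p)))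
      (fun t => x (toIcoMod hp 0 t)) (fun t => y (toIcoMod hp 0 t)) := by
    intro N
    refine (h.comp_add_const (hα.nat_mul N) (hγ.nat_mul N) (K := Ici (-(N * p))) ?_).congr ?_ ?_
    · intro t ht
      have := mem_Ici.1 ht
      simp only [mem_Ici]; linarith
    · intro t ht
      exact key x hx t N (by have := mem_Ici.1 ht; linarith)
    · intro t ht
      exact key y hy t N (by have := mem_Ici.1 ht; linarith)
  -- Strict inequality puts `t` in the interior of the half-line, where the derivative is two-sided.
  have hN : ∀ t : ℝ, ∃ N : ℕ, -(N * p) < t := fun t => by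
    obtain ⟨N, hN⟩ := exists_nat_gt (-t / p)
    rw [div_lt_iff₀ hp] at hN
    exact ⟨N, by linarith⟩
  refine ⟨fun t => x (toIcoMod hp 0 t), fun t => y (toIcoMod hp 0 t),
    ⟨fun t _ => ?_, fun t _ => ?_, fun t _ => ?_, fun t _ => ?_⟩,
    (toIcoMod_periodic hp 0).comp x, (toIcoMod_periodic hp 0).comp y⟩
  all_goals obtain ⟨N, hN⟩ := hN t
  · exact (hshift N).pos_x t hN.le
  · exact (hshift N).pos_y t hN.le
  · exact (((hshift N).deriv_x t hN.le).hasDerivAt (Ici_mem_nhds hN)).hasDerivWithinAt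
  · exact (((hshift N).deriv_y t hN.le).hasDerivAt (Ici_mem_nhds hN)).hasDerivWithinAt

lemma Function.Periodic.eq_of_tendsto_sub_zero {f g : ℝ → ℝ} {p : ℝ} (hp : 0 < p)
    (hf : Function.Periodic f p) (hg : Function.Periodic g p)
    (h : Tendsto (fun t => f t - g t) atTop (𝓝 0)) : f = g := by
  funext t
  have h₁ : Tendsto (fun n : ℕ => t + n * p) atTop atTop :=
    tendsto_atTop_add_const_left _ _ (tendsto_natCast_atTop_atTop.atTop_mul_const hp)
  have h₂ := h.comp h₁
  have h₃ : (fun t => f t - g t) ∘ (fun n : ℕ => t + n * p) = fun _ => f t - g t := by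
    funext n
    simp [hf.nat_mul n t, hg.nat_mul n t]
  rw [h₃] at h₂
  exact sub_eq_zero.1 (tendsto_nhds_unique tendsto_const_nhds h₂)

/-! ### Necessity and sufficiency of the mean value condition -/

/-- The mean value condition is necessary for the existence of a positive periodic solution. -/
lemma IsPositivePeriodicSolution.meanValue_pos {α γ : ℝ → ℝ} {p β σ ε : ℝ} {x y : ℝ → ℝ}
    (hp : 0 < p) (hβ : 0 < β) (hε : 0 < ε) (hαc : Continuous α) (hγc : Continuous γ)
    (h : IsPositivePeriodicSolution α γ β σ ε p x y) :
    0 < β * meanValue p γ - σ * meanValue p α := by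
  have hs := h.solution
  have hyc : Continuous y := continuousOn_univ.1 hs.continuousOn_y
  have hy0 : ∀ t, y t ≠ 0 := fun t => (hs.pos_y t (mem_univ t)).ne'
  have hinv : Continuous fun t => ε / y t := by fun_prop (disch := exact hy0 _)
  have hd : ∀ t ∈ uIcc 0 p, HasDerivAt (fun t => σ * x t + β * y t)
      (σ * α t - β * γ t + β * (ε / y t)) t := by
    intro t _
    have dx := ((hs.deriv_x t (mem_univ t)).hasDerivAt univ_mem).const_mul σ
    have dy := ((hs.deriv_y t (mem_univ t)).hasDerivAt univ_mem).const_mul β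
    exact (dx.add dy).congr_deriv (by ring)
  have i₁ : IntervalIntegrable (fun t => σ * α t) MeasureTheory.volume 0 p :=
    (by fun_prop : Continuous fun t => σ * α t).intervalIntegrable _ _
  have i₂ : IntervalIntegrable (fun t => β * γ t) MeasureTheory.volume 0 p :=
    (by fun_prop : Continuous fun t => β * γ t).intervalIntegrable _ _
  have i₃ : IntervalIntegrable (fun t => β * (ε / y t)) MeasureTheory.volume 0 p :=
    (by fun_prop : Continuous fun t => β * (ε / y t)).intervalIntegrable _ _
  have hint := intervalIntegral.integral_eq_sub_of_hasDerivAt hd ((i₁.sub i₂).add i₃)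
  have hx0 := h.periodic_x 0
  have hy0 := h.periodic_y 0
  rw [zero_add] at hx0 hy0
  rw [intervalIntegral.integral_add (i₁.sub i₂) i₃, intervalIntegral.integral_sub i₁ i₂, hx0, hy0,
    intervalIntegral.integral_const_mul, intervalIntegral.integral_const_mul, sub_self] at hint
  have hpos : 0 < ∫ t in (0 : ℝ)..p, β * (ε / y t) :=
    intervalIntegral.intervalIntegral_pos_of_pos i₃
      (fun t => mul_pos hβ (div_pos hε (hs.pos_y t (mem_univ t)))) hp
  have e : β * meanValue p γ - σ * meanValue p α =
      (1 / p) * ∫ t in (0 : ℝ)..p, β * (ε / y t) := by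
    rw [meanValue, meanValue]
    linear_combination (1 / p) * (-hint)
  rw [e]
  positivity

lemma Function.Periodic.exists_mem_Icc {f : ℝ → ℝ} {p : ℝ} (hp : 0 < p)
    (hf : Function.Periodic f p) (hc : Continuous f) (h0 : ∀ t, 0 < f t) :
    ∃ c A : ℝ, 0 < c ∧ ∀ t, c ≤ f t ∧ f t ≤ A := by
  have hK := hf.compact_of_continuous hp.ne' hc
  obtain ⟨_, ⟨s, rfl⟩, hs⟩ := hK.exists_isLeast (range_nonempty f)
  obtain ⟨A, -, hA⟩ := hK.exists_isGreatest (range_nonempty f)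
  exact ⟨f s, A, h0 s, fun t => ⟨hs (mem_range_self t), hA (mem_range_self t)⟩⟩

/-- The mean value condition is sufficient for the existence of a positive periodic solution: the
iterates of the period map form a Cauchy sequence, whose limit is a fixed point. -/
lemma exists_isPositivePeriodicSolution {α γ : ℝ → ℝ} {p β σ ε c A : ℝ}
    (hp : 0 < p) (hβ : 0 < β) (hσ : 0 < σ) (hε : 0 < ε) (hαc : Continuous α) (hγc : Continuous γ)
    (hαp : Function.Periodic α p) (hγp : Function.Periodic γ p)
    (hc : 0 < c) (hα : ∀ t, c ≤ α t) (hαA : ∀ t, α t ≤ A)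
    (hγ0 : ∀ t, 0 < γ t) (hγ : ∀ t, γ t ≤ A)
    (hδ : 0 < β * meanValue p γ - σ * meanValue p α) :
    ∃ x y : ℝ → ℝ, IsPositivePeriodicSolution α γ β σ ε p x y := by
  have hA : 0 < A := (hγ0 0).trans_le (hγ 0)
  obtain ⟨x, y, h, -, -, m, hm, hlow⟩ := exists_isPositiveSolutionOn_Ici hβ hσ hε hαc hγc hc hα hαA
    hγ0 hγ zero_lt_one zero_lt_one 0
  obtain ⟨M, hM, hup⟩ := h.exists_upper_bound hp hβ hσ hε hαc hγc hαp hγp hA hγ hδ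
  have hmaps : MapsTo (· + p) (Ici (0 : ℝ)) (Ici 0) := fun t ht =>
    add_nonneg (mem_Ici.1 ht) hp.le
  obtain ⟨C, k, hk, hexp⟩ := (h.comp_add_const hαp hγp hmaps).exists_exp_dist_le hβ hσ hε hM h
    (fun t ht => (hup _ (hmaps ht)).2) (fun t ht => (hup t ht).1) (fun t ht => (hup t ht).2)
  simp only [sub_zero] at hexp
  obtain ⟨x₀, hx₀⟩ := cauchySeq_tendsto_of_complete
    (cauchySeq_of_exp_bound hk hp fun t ht => (hexp t ht).1)
  obtain ⟨y₀, hy₀⟩ := cauchySeq_tendsto_of_complete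
    (cauchySeq_of_exp_bound hk hp fun t ht => (hexp t ht).2)
  have hnp : ∀ n : ℕ, (n : ℝ) * p ∈ Ici (0 : ℝ) := fun n => by simp only [mem_Ici]; positivity
  -- The lower bound `m`, uniform in time, keeps the limit off the coordinate axes.
  have hx₀pos : 0 < x₀ := hm.trans_le (ge_of_tendsto' hx₀ fun n => (hlow _ (hnp n)).1)
  have hy₀pos : 0 < y₀ := hm.trans_le (ge_of_tendsto' hy₀ fun n => (hlow _ (hnp n)).2)
  obtain ⟨X, Y, hXY, hX, hY, -⟩ := exists_isPositiveSolutionOn_Ici hβ hσ hε hαc hγc hc hα hαA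
    hγ0 hγ hx₀pos hy₀pos 0
  -- By nonexpansiveness over one period, the distance from `(X p, Y p)` to iterate `n + 1` is at
  -- most that from `(x₀, y₀)` to iterate `n`, which tends to zero.
  have hfix : X p = x₀ ∧ Y p = y₀ := by
    refine eq_and_eq_of_weighted_abs_le hβ hσ ?_
    have hlim₁ := ((((tendsto_add_atTop_iff_nat 1).2 hx₀).const_sub (X p)).abs.const_mul σ).add
      ((((tendsto_add_atTop_iff_nat 1).2 hy₀).const_sub (Y p)).abs.const_mul β)
    have hlim₂ := ((hx₀.const_sub x₀).abs.const_mul σ).add ((hy₀.const_sub y₀).abs.const_mul β)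
    simp only [sub_self, abs_zero, mul_zero, add_zero] at hlim₂
    refine le_of_tendsto_of_tendsto' hlim₁ hlim₂ fun n => ?_
    have hsh := h.comp_add_const (hαp.nat_mul n) (hγp.nat_mul n) (K := Ici (0 : ℝ))
      (fun t ht => add_nonneg (mem_Ici.1 ht) (hnp n))
    have := (hXY.mono Icc_subset_Ici_self).dist_le hβ hσ hε (hsh.mono Icc_subset_Ici_self)
      (right_mem_Icc.2 hp.le)
    rw [hX, hY, zero_add] at this
    push_cast
    rwa [add_one_mul, add_comm _ p]
  have hper : ∀ t ∈ Ici (0 : ℝ), X (t + p) = X t ∧ Y (t + p) = Y t := fun t ht =>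
    ((hXY.comp_add_const hαp hγp hmaps).mono Icc_subset_Ici_self).eqOn hβ hσ hε
      (hXY.mono Icc_subset_Ici_self) (by rw [zero_add, hfix.1, hX]) (by rw [zero_add, hfix.2, hY])
      ⟨ht, le_rfl⟩
  exact hXY.exists_periodic_extension hp hαp hγp (fun t ht => (hper t ht).1)
    fun t ht => (hper t ht).2

/-- Any two positive solutions on a half-line approach each other when the mean value condition
holds. -/
lemma IsPositiveSolutionOn.tendsto_sub_zero {α γ : ℝ → ℝ} {p β σ ε A a : ℝ} {x y u v : ℝ → ℝ}
    (hp : 0 < p) (hβ : 0 < β) (hσ : 0 < σ) (hε : 0 < ε) (hαc : Continuous α) (hγc : Continuous γ)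
    (hαp : Function.Periodic α p) (hγp : Function.Periodic γ p) (hA : 0 < A) (hγ : ∀ t, γ t ≤ A)
    (hδ : 0 < β * meanValue p γ - σ * meanValue p α)
    (h : IsPositiveSolutionOn α γ β σ ε (Ici a) u v)
    (h' : IsPositiveSolutionOn α γ β σ ε (Ici a) x y) :
    Tendsto (fun t => u t - x t) atTop (𝓝 0) ∧ Tendsto (fun t => v t - y t) atTop (𝓝 0) := by
  obtain ⟨M, hM, hup⟩ := h.exists_upper_bound hp hβ hσ hε hαc hγc hαp hγp hA hγ hδ
  obtain ⟨M', -, hup'⟩ := h'.exists_upper_bound hp hβ hσ hε hαc hγc hαp hγp hA hγ hδ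
  obtain ⟨C, k, hk, hexp⟩ := h.exists_exp_dist_le hβ hσ hε (lt_max_of_lt_left hM) h'
    (fun t ht => le_max_of_le_left (hup t ht).2) (fun t ht => le_max_of_le_right (hup' t ht).1)
    (fun t ht => le_max_of_le_right (hup' t ht).2)
  exact ⟨tendsto_sub_zero_of_exp_bound hk fun t ht => (hexp t ht).1,
    tendsto_sub_zero_of_exp_bound hk fun t ht => (hexp t ht).2⟩

theorem theorem2 (p β σ ε : ℝ) (hp : 0 < p) (hβ : 0 < β) (hσ : 0 < σ) (hε : 0 < ε)
    (α γ : ℝ → ℝ) (hα_cont : Continuous α) (hγ_cont : Continuous γ)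
    (hα_per : Function.Periodic α p) (hγ_per : Function.Periodic γ p)
    (hα_pos : ∀ t, 0 < α t) (hγ_pos : ∀ t, 0 < γ t) :
    ((∃ x y : ℝ → ℝ, IsPositivePeriodicSolution α γ β σ ε p x y) ↔
      0 < β * meanValue p γ - σ * meanValue p α) ∧
    (0 < β * meanValue p γ - σ * meanValue p α →
      ∃ x y : ℝ → ℝ, IsPositivePeriodicSolution α γ β σ ε p x y ∧
        (∀ u v : ℝ → ℝ, IsPositivePeriodicSolution α γ β σ ε p u v → u = x ∧ v = y) ∧
        (∀ t₀ u₀ v₀ : ℝ, 0 < u₀ → 0 < v₀ →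
          ∃ u v : ℝ → ℝ, IsPositiveSolutionOn α γ β σ ε (Ici t₀) u v ∧ u t₀ = u₀ ∧ v t₀ = v₀) ∧
        (∀ (t₀ : ℝ) (u v : ℝ → ℝ), IsPositiveSolutionOn α γ β σ ε (Ici t₀) u v →
          Tendsto (fun t => u t - x t) atTop (𝓝 0) ∧
          Tendsto (fun t => v t - y t) atTop (𝓝 0))) := by

  obtain ⟨c, A₁, hc, hα⟩ := hα_per.exists_mem_Icc hp hα_cont hα_pos
  obtain ⟨_, A₂, _, hγ⟩ := hγ_per.exists_mem_Icc hp hγ_cont hγ_pos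
  have hαA : ∀ t, α t ≤ max A₁ A₂ := fun t => le_max_of_le_left (hα t).2
  have hγA : ∀ t, γ t ≤ max A₁ A₂ := fun t => le_max_of_le_right (hγ t).2
  have hA : 0 < max A₁ A₂ := (hγ_pos 0).trans_le (hγA 0)
  have hex := fun hδ => exists_isPositivePeriodicSolution hp hβ hσ hε hα_cont hγ_cont hα_per hγ_per
    hc (fun t => (hα t).1) hαA hγ_pos hγA hδ
  refine ⟨⟨fun ⟨x, y, h⟩ => h.meanValue_pos hp hβ hε hα_cont hγ_cont, hex⟩, fun hδ => ?_⟩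
  obtain ⟨x, y, h⟩ := hex hδ
  have hattr : ∀ (t₀ : ℝ) (u v : ℝ → ℝ), IsPositiveSolutionOn α γ β σ ε (Ici t₀) u v →
      Tendsto (fun t => u t - x t) atTop (𝓝 0) ∧ Tendsto (fun t => v t - y t) atTop (𝓝 0) :=
    fun t₀ u v huv => huv.tendsto_sub_zero hp hβ hσ hε hα_cont hγ_cont hα_per hγ_per hA hγA hδ
      (h.solution.mono (subset_univ _))
  refine ⟨x, y, h, fun u v huv => ?_, fun t₀ u₀ v₀ hu₀ hv₀ => ?_, hattr⟩
  -- A second periodic solution is attracted too, and a periodic difference that tends to zero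
  -- vanishes.
  · obtain ⟨h₁, h₂⟩ := hattr 0 u v (huv.solution.mono (subset_univ _))
    exact ⟨huv.periodic_x.eq_of_tendsto_sub_zero hp h.periodic_x h₁,
      huv.periodic_y.eq_of_tendsto_sub_zero hp h.periodic_y h₂⟩
  · obtain ⟨u, v, huv, hu, hv, -⟩ := exists_isPositiveSolutionOn_Ici hβ hσ hε hα_cont hγ_cont hc
      (fun t => (hα t).1) hαA hγ_pos hγA hu₀ hv₀ t₀
    exact ⟨u, v, huv, hu, hv⟩
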